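/- Let $X$ be a complex Banach space and $L(X)$ the algebra of bounded linear operators on $X$. Let $\sigma_*$ be one of the following three spectra: the spectrum $\sigma$; the Browder spectrum $\sigma_b(T)=\{\lambda\in\mathbb C: T-\lambda I$ is not a Fredholm operator of finite ascent and finite descent$\}$; the Drazin spectrum $\sigma_d(T)=\{\lambda\in\mathbb C: T-\lambda I$ is not Drazin invertible$\}$ (an operator $A$ is Drazin invertible if there are a bounded operator $S$ and $k\in\mathbb N$ with $AS=SA$, $SAS=S$ and $A^{k+1}S=A^k$). For $A\subset\mathbb C$ let $\operatorname{acc}A$ be the set of accumulation points of $A$ in $\mathbb C$, and define by transfinite recursion $\operatorname{acc}^0A=A$, $\operatorname{acc}^{\alpha+1}A=\operatorname{acc}(\operatorname{acc}^\alpha A)$, and $\operatorname{acc}^\alpha A=\bigcap_{\beta<\alpha}\operatorname{acc}^\beta A$ for a limit ordinal $\alpha$. The Cantor–Bendixson rank $\operatorname{CBR}(A)$ is the least ordinal $\alpha$ with $\operatorname{acc}^\alpha A=\operatorname{acc}^{\alpha+1}A$. Let $\omega_1$ be the first uncountable ordinal. For $T\in L(X)$ write $(M,N)\in\operatorname{Red}(T)$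 if $M,N$ are closed $T$-invariant subspaces with $X=M\oplus N$, and let $T_M,T_N$ be the restrictions of $T$. Call $T$ *almost invertible* if there is $(M,N)\in\operatorname{Red}(T)$ such that $T_M$ is invertible and $\sigma(T_N)$ is at most countable, and put $\sigma_{al}(T)=\{\lambda\in\mathbb C: T-\lambda I\text{ is not almost invertible}\}$. Call $T$ $g_{\sigma_*}^{0}$-*invertible* if $0\notin\sigma_*(T)$; $g_{\sigma_*}^{\beta+1}$-*invertible* if there is $(M,N)\in\operatorname{Red}(T)$ such that $T_M$ is invertible and $\operatorname{acc}^{\beta}\sigma_*(T_N)\subset\{0\}$; and, for a limit ordinal $\alpha$, $g_{\sigma_*}^{\alpha}$-*invertible* if it is $g_{\sigma_*}^{\beta}$-invertible for some successor ordinal $\beta<\alpha$. **Theorem.** Let $T\in L(X)$ and $r_*=\operatorname{CBR}(\sigma_*(T))$. Then $T$ is almost invertible if and only if $T$ is $g_{\sigma_*}^{\omega_1}$-invertible, if and only if $T$ is $g_{\sigma_*}^{r_*}$-invertible. Consequently the set of almost invertible operators in $L(X)$, the set of $g_{\sigma_*}^{\omega_1}$-invertible operators, and the set of operators $T$ that are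 $g_{\sigma_*}^{r_*}$-invertible with $r_*=\operatorname{CBR}(\sigma_*(T))$ coincide, and for every $T\in L(X)$ $$\sigma_{al}(T)=\operatorname{acc}^{\omega_1}\sigma_*(T)=\operatorname{acc}^{r_*}\sigma_*(T).$$ In particular, $T$ is almost invertible if and only if $0\notin\operatorname{acc}^{\omega_1}\sigma(T)$. -/

import Mathlib

open scoped Ordinal

noncomputable section

namespace AlmostInv

/-! ### Cantor–Bendixson derivatives of subsets of the complex plane -/

/-- The `α`-th Cantor–Bendixson derivative `acc^α A` of `A ⊆ ℂ`: `acc^0 A = A`,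
`acc^(α+1) A = acc (acc^α A)`, and `acc^α A = ⋂ β < α, acc^β A` for `α` a limit ordinal, where
`acc` is the set of accumulation points in `ℂ`. -/
def accIter (A : Set ℂ) (α : Ordinal.{0}) : Set ℂ :=
  Ordinal.limitRecOn (motive := fun _ => Set ℂ) α A
    (fun _ S => derivedSet S)
    (fun γ _ S => ⋂ (β : Ordinal.{0}) (h : β < γ), S β h)

theorem accIter_zero (A : Set ℂ) : accIter A 0 = A :=
  Ordinal.limitRecOn_zero ..

theorem accIter_add_one (A : Set ℂ) (α : Ordinal.{0}) :
    accIter A (α + 1) = derivedSet (accIter A α) :=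
  Ordinal.limitRecOn_add_one ..

theorem accIter_limit (A : Set ℂ) {α : Ordinal.{0}} (hα : Order.IsSuccLimit α) :
    accIter A α = ⋂ (β : Ordinal.{0}) (_ : β < α), accIter A β :=
  Ordinal.limitRecOn_limit _ _ _ _ hα

/-- On closed sets, `accIter` is the iterated derived set of Mathlib. -/
theorem accIter_eq_iteratedDerivedSet {A : Set ℂ} (hA : IsClosed A) (α : Ordinal.{0}) :
    accIter A α = CantorBendixson.iteratedDerivedSet A α := by
  induction α using Ordinal.limitRecOn with
  | zero => rw [accIter_zero, CantorBendixson.iteratedDerivedSet_zero]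
  | add_one a ih =>
    rw [accIter_add_one, CantorBendixson.iteratedDerivedSet_succ, ih,
      (CantorBendixson.isClosed_iteratedDerivedSet hA a).relDerivedSet_eq]
  | limit a ha ih =>
    rw [accIter_limit A ha, CantorBendixson.iteratedDerivedSet_limit ha]
    ext x
    simp only [Set.mem_iInter, Subtype.forall, Set.mem_Iio]
    exact forall₂_congr fun b hb => by rw [ih b hb]

/-- The Cantor–Bendixson rank of `A`: the least ordinal `α` with `acc^α A = acc^(α+1) A`. -/
def cbRank (A : Set ℂ) : Ordinal.{0} :=
  sInf {α : Ordinal.{0} | accIter A α = accIter A (α + 1)}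

/-- The set over which the infimum defining the rank is taken is nonempty for closed sets, so that
the rank is really attained. -/
theorem accIter_cbRank {A : Set ℂ} (hA : IsClosed A) :
    accIter A (cbRank A) = accIter A (cbRank A + 1) := by
  have h : {α : Ordinal.{0} | accIter A α = accIter A (α + 1)}.Nonempty := by
    obtain ⟨a, ha⟩ := CantorBendixson.iteratedDerivedSet_mem_fixedPoints A
    refine ⟨a, ?_⟩
    rw [Set.mem_ofPred_eq, accIter_eq_iteratedDerivedSet hA, accIter_eq_iteratedDerivedSet hA,
      CantorBendixson.iteratedDerivedSet_succ]
    exact (Function.mem_fixedPoints_iff.mp ha).symm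
  exact csInf_mem h

/-! ### Spectra -/

section Spectra

variable {E : Type*} [NormedAddCommGroup E] [NormedSpace ℂ E]

/-- `T` has finite ascent: `N(T^n) = N(T^(n+1))` for some `n`. -/
def HasFiniteAscent (T : E →L[ℂ] E) : Prop :=
  ∃ n : ℕ, (T ^ n).ker = (T ^ (n + 1)).ker

/-- `T` has finite descent: `R(T^n) = R(T^(n+1))` for some `n`. -/
def HasFiniteDescent (T : E →L[ℂ] E) : Prop :=
  ∃ n : ℕ, (T ^ n).range = (T ^ (n + 1)).range

/-- `T` is a Browder operator: Fredholm of finite ascent and finite descent. -/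
def IsBrowder (T : E →L[ℂ] E) : Prop :=
  T.IsFredholm ∧ HasFiniteAscent T ∧ HasFiniteDescent T

/-- `T` is Drazin invertible: it has a Drazin inverse, i.e. there is a bounded operator `S` with
`TS = ST`, `STS = S` and `T^(k+1) S = T^k` for some `k ≥ 0`. -/
def IsDrazinInvertible (T : E →L[ℂ] E) : Prop :=
  ∃ S : E →L[ℂ] E, T * S = S * T ∧ S * T * S = S ∧ ∃ k : ℕ, T ^ (k + 1) * S = T ^ k

/-- The Browder spectrum. -/
def browderSpectrum (T : E →L[ℂ] E) : Set ℂ :=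
  {z : ℂ | ¬ IsBrowder (T - z • (1 : E →L[ℂ] E))}

/-- The Drazin spectrum. -/
def drazinSpectrum (T : E →L[ℂ] E) : Set ℂ :=
  {z : ℂ | ¬ IsDrazinInvertible (T - z • (1 : E →L[ℂ] E))}

end Spectra

/-- The three possible choices of `σ_*`. -/
inductive SpectrumKind : Type
  | ordinary
  | browder
  | drazin

/-- `σ_*(T)`, where `σ_*` is the spectrum, the Browder spectrum or the Drazin spectrum. -/
def sigmaStar (k : SpectrumKind) {E : Type*} [NormedAddCommGroup E] [NormedSpace ℂ E]
    (T : E →L[ℂ] E) : Set ℂ :=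
  match k with
  | .ordinary => spectrum ℂ T
  | .browder => browderSpectrum T
  | .drazin => drazinSpectrum T

/-! ### Decompositions and the classes of operators -/

section Classes

variable {X : Type*} [NormedAddCommGroup X] [NormedSpace ℂ X]

/-- `(M, N) ∈ Red(T)`: `M` and `N` are closed `T`-invariant subspaces with `X = M ⊕ N`. -/
structure Red (T : X →L[ℂ] X) (M N : Submodule ℂ X) : Prop where
  isClosed_left : IsClosed (M : Set X)
  isClosed_right : IsClosed (N : Set X)
  invariant_left : ∀ x ∈ M, T x ∈ M
  invariant_right : ∀ x ∈ N, T x ∈ N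
  isCompl : IsCompl M N

/-- `T` is almost invertible: there is `(M, N) ∈ Red(T)` such that `T_M` is invertible and
`σ(T_N)` is at most countable. -/
def AlmostInvertible (T : X →L[ℂ] X) : Prop :=
  ∃ (M N : Submodule ℂ X) (h : Red T M N),
    IsUnit (T.restrict h.invariant_left) ∧
    (spectrum ℂ (T.restrict h.invariant_right)).Countable

/-- `σ_al(T)`, the set of `z ∈ ℂ` such that `T - zI` is not almost invertible. -/
def sigmaAl (T : X →L[ℂ] X) : Set ℂ :=
  {z : ℂ | ¬ AlmostInvertible (T - z • (1 : X →L[ℂ] X))}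

/-- `g^(β+1)`-invertibility with respect to `σ_*`: there is `(M, N) ∈ Red(T)` such that `T_M` is
invertible and `acc^β σ_*(T_N) ⊆ {0}`. -/
def GInvertibleSucc (k : SpectrumKind) (T : X →L[ℂ] X) (β : Ordinal.{0}) : Prop :=
  ∃ (M N : Submodule ℂ X) (h : Red T M N),
    IsUnit (T.restrict h.invariant_left) ∧
    accIter (sigmaStar k (T.restrict h.invariant_right)) β ⊆ {0}

/-- `g^α`-invertibility with respect to `σ_*`. For `α = 0` it means `0 ∉ σ_*(T)`; for a successor
`α = β + 1` it is `GInvertibleSucc k T β`; for a limit ordinal `α` it means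
`g^(β+1)`-invertibility for some successor ordinal `β + 1 < α`. -/
def GInvertible (k : SpectrumKind) (T : X →L[ℂ] X) (α : Ordinal.{0}) : Prop :=
  (α = 0 ∧ (0 : ℂ) ∉ sigmaStar k T) ∨
  (∃ β : Ordinal.{0}, α = β + 1 ∧ GInvertibleSucc k T β) ∨
  (Order.IsSuccLimit α ∧ ∃ β : Ordinal.{0}, β + 1 < α ∧ GInvertibleSucc k T β)

end Classes

end AlmostInv

end

noncomputable section

namespace AlmostInv

/-! ### Cantor–Bendixson derivatives -/

section CantorBendixsonDerivative

open Topology Filter Set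

/-! Every notion of invertibility here is equivalent to `0 ∉ acc^α σ_*(T)` for the matching `α`; the
statements about spectra follow by translating `T`, and the role of `ω₁` is the Cantor–Bendixson
theorem for the closed set `σ_*(T)`.

From a splitting to the spectrum: if `T_M` is invertible, then near `0` the set `σ_*(T)` lies in
`σ_*(T_N)`, and `acc^α` is local (`accIter_inter_subset`), so smallness of the spectrum of `T_N`
passes to `σ_*(T)` near `0`.

From the spectrum to a splitting: if `σ_*(T)` is countable near `0`, so is `σ(T)`, because a point
of `σ(T)` outside `σ_*(T)` is isolated in `σ(T)`. Countably many points have countably many moduli,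
so arbitrarily small circles around `0` miss `σ(T)`, and the Riesz projection of such a circle
splits `T` (`exists_red_of_countable`). The hypothesis holds in both cases: `A \ acc^β A` is always
countable for closed `A`, and `0 ∉ acc^{β+1} A` says that `acc^β A` has no point but possibly `0`
near `0`.

For `ω₁`: the derivatives lose a new point at each stage below the rank and only countably many
points in total, so the rank is countable and `acc^{ω₁}` is perfect. Nonempty perfect sets are
uncountable, so `0 ∉ acc^{ω₁} σ_*(T)` means exactly that `σ_*(T)` is countable near `0`. -/

theorem isClosed_accIter {A : Set ℂ} (hA : IsClosed A) (α : Ordinal.{0}) :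
    IsClosed (accIter A α) := by
  rw [accIter_eq_iteratedDerivedSet hA]
  exact CantorBendixson.isClosed_iteratedDerivedSet hA α

theorem accIter_antitone {A : Set ℂ} (hA : IsClosed A) : Antitone (accIter A) := by
  intro α β h
  rw [accIter_eq_iteratedDerivedSet hA, accIter_eq_iteratedDerivedSet hA]
  exact CantorBendixson.iteratedDerivedSet_antitone A h

theorem accIter_subset {A : Set ℂ} (hA : IsClosed A) (α : Ordinal.{0}) : accIter A α ⊆ A := by
  simpa only [accIter_zero] using accIter_antitone hA (zero_le : 0 ≤ α)

/-- The derivatives `acc^α` are local: inside an open set `U` they only see the trace on `U`. -/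
theorem accIter_inter_subset {A B U : Set ℂ} (hU : IsOpen U) (h : A ∩ U ⊆ B)
    (α : Ordinal.{0}) : accIter A α ∩ U ⊆ accIter B α := by
  induction α using Ordinal.limitRecOn with
  | zero => simpa only [accIter_zero] using h
  | add_one a ih =>
    rw [accIter_add_one, accIter_add_one]
    rintro x ⟨hx, hxU⟩
    refine (AccPt.nhds_inter (mem_derivedSet.1 hx) (hU.mem_nhds hxU)).mono ?_
    rw [inter_comm]
    exact principal_mono.2 ih
  | limit a ha ih =>
    rw [accIter_limit A ha, accIter_limit B ha]
    rintro x ⟨hx, hxU⟩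
    simp only [mem_iInter] at hx ⊢
    exact fun b hb => ih b hb ⟨hx b hb, hxU⟩

theorem accIter_mono {A B : Set ℂ} (h : A ⊆ B) (α : Ordinal.{0}) :
    accIter A α ⊆ accIter B α := by
  simpa using accIter_inter_subset isOpen_univ (inter_subset_left.trans h) α

theorem derivedSet_preimage_homeomorph {X Y : Type*} [TopologicalSpace X] [TopologicalSpace Y]
    (e : X ≃ₜ Y) (A : Set Y) : derivedSet (e ⁻¹' A) = e ⁻¹' derivedSet A := by
  apply subset_antisymm
  · intro x hx
    have := e.continuous.image_derivedSet e.injective (mem_image_of_mem e hx)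
    rwa [image_preimage_eq _ e.surjective] at this
  · intro x hx
    have := e.symm.continuous.image_derivedSet e.symm.injective (mem_image_of_mem e.symm hx)
    rwa [e.symm_apply_apply, e.symm.image_eq_preimage_symm, e.symm_symm] at this

theorem accIter_preimage_homeomorph (e : ℂ ≃ₜ ℂ) (A : Set ℂ) (α : Ordinal.{0}) :
    accIter (e ⁻¹' A) α = e ⁻¹' accIter A α := by
  induction α using Ordinal.limitRecOn with
  | zero => simp only [accIter_zero]
  | add_one a ih => rw [accIter_add_one, accIter_add_one, ih, derivedSet_preimage_homeomorph]
  | limit a ha ih =>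
    simp only [accIter_limit _ ha, preimage_iInter]
    exact iInter₂_congr ih

/-- A limit stage is an intersection, so it drops only points already dropped earlier: every point
leaves at a successor step. -/
theorem exists_mem_accIter_notMem_accIter_add_one {A : Set ℂ} {x : ℂ} (hx : x ∈ A)
    {α : Ordinal.{0}} (hα : x ∉ accIter A α) :
    ∃ γ, x ∈ accIter A γ ∧ x ∉ accIter A (γ + 1) := by
  induction α using Ordinal.limitRecOn with
  | zero => exact absurd hx (by rwa [accIter_zero] at hα)
  | add_one a ih =>
    by_cases h : x ∈ accIter A a
    · exact ⟨a, h, hα⟩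
    · exact ih h
  | limit a ha ih =>
    rw [accIter_limit A ha] at hα
    simp only [mem_iInter, not_forall] at hα
    obtain ⟨b, hb, h⟩ := hα
    exact ih b hb h

/-- A point leaving after stage `γ` is isolated in `acc^γ A` by some member `V` of a countable
basis. The map from points to `V` is injective: if two points share `V`, the one with the larger
stage also lies in the other's derivative, hence equals it. -/
theorem countable_diff_accIter {A : Set ℂ} (hA : IsClosed A) (α : Ordinal.{0}) :
    (A \ accIter A α).Countable := by
  have key : ∀ x ∈ A \ accIter A α, ∃ γ, x ∈ accIter A γ ∧
      ∃ V ∈ TopologicalSpace.countableBasis ℂ, x ∈ V ∧ ∀ y ∈ V ∩ accIter A γ, y = x := by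
    rintro x ⟨hx, hxα⟩
    obtain ⟨γ, h₁, h₂⟩ := exists_mem_accIter_notMem_accIter_add_one hx hxα
    rw [accIter_add_one, mem_derivedSet, accPt_iff_nhds] at h₂
    push Not at h₂
    obtain ⟨U, hU, h⟩ := h₂
    obtain ⟨V, hV, hxV, hVU⟩ :=
      (TopologicalSpace.isBasis_countableBasis ℂ).mem_nhds_iff.1 hU
    exact ⟨γ, h₁, V, hV, hxV, fun y hy => h y ⟨hVU hy.1, hy.2⟩⟩
  choose! γ hγ V hV hxV hVx using key
  refine MapsTo.countable_of_injOn (f := V) hV ?_ (TopologicalSpace.countable_countableBasis ℂ)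
  intro x hx y hy hxy
  rcases le_total (γ x) (γ y) with h | h
  · exact (hVx x hx y ⟨hxy ▸ hxV y hy, accIter_antitone hA h (hγ y hy)⟩).symm
  · exact hVx y hy x ⟨hxy ▸ hxV x hx, accIter_antitone hA h (hγ x hx)⟩

theorem accIter_eq_of_cbRank_le {A : Set ℂ} (hA : IsClosed A) {α : Ordinal.{0}}
    (h : cbRank A ≤ α) : accIter A α = accIter A (cbRank A) := by
  induction α using Ordinal.limitRecOn with
  | zero => rw [le_antisymm h zero_le]
  | add_one a ih =>
    rcases h.lt_or_eq with h | h
    · rw [accIter_add_one, ih (Order.lt_add_one_iff.1 h), ← accIter_add_one, ← accIter_cbRank hA]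
    · rw [h]
  | limit a ha ih =>
    rcases h.lt_or_eq with h | h
    · refine subset_antisymm (accIter_antitone hA h.le) ?_
      rw [accIter_limit A ha]
      refine subset_iInter₂ fun b hb => ?_
      rcases le_total (cbRank A) b with h' | h'
      · exact (ih b hb h').ge
      · exact accIter_antitone hA h'
    · rw [h]

theorem accIter_add_one_ssubset_of_lt_cbRank {A : Set ℂ} (hA : IsClosed A) {α : Ordinal.{0}}
    (h : α < cbRank A) : accIter A (α + 1) ⊂ accIter A α := by
  refine (accIter_antitone hA (Order.le_succ α)).ssubset_of_ne fun h' => ?_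
  exact notMem_of_lt_csInf h (OrderBot.bddBelow _) h'.symm

/-- The Cantor–Bendixson rank of a closed set is countable. -/
theorem cbRank_lt_omega_one {A : Set ℂ} (hA : IsClosed A) : cbRank A < ω₁ := by
  -- Choosing a point lost at each stage below the rank injects the ordinals below the rank into the
  -- countable set `A \ accIter A (cbRank A)`.
  have key : ∀ α : Iio (cbRank A), ∃ x, x ∈ accIter A α ∧ x ∉ accIter A (α + 1) := fun α =>
    exists_of_ssubset (accIter_add_one_ssubset_of_lt_cbRank hA α.2)
  choose f hf hf' using key
  have hinj : Function.Injective f := by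
    have : ∀ α β, α < β → f α ≠ f β := fun α β h h' =>
      hf' α (h' ▸ accIter_antitone hA (Order.add_one_le_of_lt (Subtype.coe_lt_coe.2 h)) (hf β))
    intro α β h
    by_contra hne
    rcases lt_or_gt_of_ne hne with hlt | hlt
    · exact this _ _ hlt h
    · exact this _ _ hlt h.symm
  have hmem : ∀ α, f α ∈ A \ accIter A (cbRank A) := fun α =>
    ⟨accIter_subset hA _ (hf α),
      fun h => hf' α (accIter_antitone hA (Order.add_one_le_of_lt α.2) h)⟩
  have hc : (Iio (cbRank A)).Countable := by
    have := (countable_diff_accIter hA (cbRank A)).to_subtype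
    exact (hinj.codRestrict hmem).countable
  rw [Cardinal.lt_omega_iff_card_lt]
  have h := hc.le_aleph0
  rw [Cardinal.mk_Iio_ordinal, ← Cardinal.lift_aleph0.{1, 0}, Cardinal.lift_le] at h
  exact h.trans_lt Cardinal.aleph0_lt_aleph_one

theorem accIter_omega_one {A : Set ℂ} (hA : IsClosed A) :
    accIter A ω₁ = accIter A (cbRank A) :=
  accIter_eq_of_cbRank_le hA (cbRank_lt_omega_one hA).le

/-- A closed set is uncountable near each point of its perfect kernel, and only there. -/
theorem notMem_accIter_omega_one_iff {A : Set ℂ} (hA : IsClosed A) {z : ℂ} :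
    z ∉ accIter A ω₁ ↔ ∃ U ∈ 𝓝 z, (A ∩ U).Countable := by
  constructor
  · intro hz
    refine ⟨_, (isClosed_accIter hA ω₁).isOpen_compl.mem_nhds hz, ?_⟩
    exact countable_diff_accIter hA ω₁
  · rintro ⟨U, hU, hc⟩ hz
    have hperf : Perfect (accIter A ω₁) := by
      rw [accIter_omega_one hA, perfect_iff_eq_derivedSet, ← accIter_add_one]
      exact accIter_cbRank hA
    -- A closed ball inside `U` keeps the closure of the trace of the kernel on the open ball inside
    -- `A ∩ U`. That closure is perfect and nonempty, so it contains an injective image of `ℕ →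
    -- Bool`.
    obtain ⟨ε, hε, hεU⟩ := Metric.nhds_basis_closedBall.mem_iff.1 hU
    obtain ⟨hp, hne⟩ :=
      hperf.closure_nhds_inter z hz (Metric.mem_ball_self hε) Metric.isOpen_ball
    obtain ⟨f, hfr, -, hf⟩ := hp.exists_nat_bool_injection hne
    have hsub : closure (Metric.ball z ε ∩ accIter A ω₁) ⊆ A ∩ U := by
      refine subset_inter ?_ ?_
      · exact closure_minimal (inter_subset_right.trans (accIter_subset hA _)) hA
      · refine (closure_minimal (inter_subset_left.trans Metric.ball_subset_closedBall)
          Metric.isClosed_closedBall).trans hεU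
    have := (hc.mono (hfr.trans hsub)).to_subtype
    have hunc : Uncountable (ℕ → Bool) := by
      rw [← Cardinal.aleph0_lt_mk_iff]
      simpa using Cardinal.aleph0_lt_continuum
    exact not_countable (α := ℕ → Bool) (hf.codRestrict fun x => mem_range_self x).countable

end CantorBendixsonDerivative

/-! ### The Riesz projection of a circle -/

section RieszProjection

open Complex Set MeasureTheory Metric
open scoped Real Topology

theorem circleIntegral_clm_apply {E F : Type*} [NormedAddCommGroup E] [NormedSpace ℂ E]
    [CompleteSpace E] [NormedAddCommGroup F] [NormedSpace ℂ F] [CompleteSpace F] (L : E →L[ℂ] F)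
    {f : ℂ → E} {c : ℂ} {R : ℝ} (hf : CircleIntegrable f c R) :
    L (∮ z in C(c, R), f z) = ∮ z in C(c, R), L (f z) := by
  simp only [circleIntegral]
  rw [← L.intervalIntegral_comp_comm hf.out]
  simp only [map_smul]

theorem circleIntegral_comm {E : Type*} [NormedAddCommGroup E] [NormedSpace ℂ E]
    {f : ℂ → ℂ → E} {c d : ℂ} {r R : ℝ} (hr : 0 ≤ r) (hR : 0 ≤ R)
    (hf : ContinuousOn (Function.uncurry f) (sphere c r ×ˢ sphere d R)) :
    (∮ z in C(c, r), ∮ w in C(d, R), f z w) = ∮ w in C(d, R), ∮ z in C(c, r), f z w := by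
  have hcont : Continuous (Function.uncurry fun θ φ : ℝ =>
      deriv (circleMap c r) θ • deriv (circleMap d R) φ • f (circleMap c r θ) (circleMap d R φ)) := by
    have h1 : Continuous fun p : ℝ × ℝ => f (circleMap c r p.1) (circleMap d R p.2) :=
      hf.comp_continuous (f := fun p : ℝ × ℝ => (circleMap c r p.1, circleMap d R p.2))
        (by fun_prop) fun p =>
          ⟨circleMap_mem_sphere c hr _, circleMap_mem_sphere d hR _⟩
    have h2 : ∀ (c : ℂ) (r : ℝ), Continuous (deriv (circleMap c r)) := fun c r => by
      simp only [funext (deriv_circleMap c r)]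
      fun_prop
    exact ((h2 c r).comp continuous_fst).smul (((h2 d R).comp continuous_snd).smul h1)
  simp only [circleIntegral, ← intervalIntegral.integral_smul]
  rw [intervalIntegral_intervalIntegral_swap (hcont.continuousOn.integrableOn_compact
    (isCompact_uIcc.prod isCompact_uIcc) |>.mono_set
      (prod_mono uIoc_subset_uIcc uIoc_subset_uIcc))]
  simp only [smul_comm (deriv (circleMap d R) _)]

variable {A : Type*} [NormedRing A] [NormedAlgebra ℂ A]

theorem continuousOn_resolvent [CompleteSpace A] (a : A) :
    ContinuousOn (resolvent a) (resolventSet ℂ a) :=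
  fun _ hz => (spectrum.hasDerivAt_resolvent_const_left hz).continuousAt.continuousWithinAt

theorem mul_resolvent {a : A} {z : ℂ} (hz : z ∈ resolventSet ℂ a) :
    (algebraMap ℂ A z - a) * resolvent a z = 1 :=
  Ring.mul_inverse_cancel _ hz

theorem resolvent_mul {a : A} {z : ℂ} (hz : z ∈ resolventSet ℂ a) :
    resolvent a z * (algebraMap ℂ A z - a) = 1 :=
  Ring.inverse_mul_cancel _ hz

theorem commute_resolvent {a : A} {z : ℂ} (hz : z ∈ resolventSet ℂ a) :
    Commute a (resolvent a z) := by
  have h := (mul_resolvent hz).trans (resolvent_mul hz).symm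
  rw [sub_mul, mul_sub, Algebra.commutes] at h
  exact sub_right_injective h

/-- The Cauchy transform of the resolvent along a circle centred at `0`. -/
def cauchyResolvent (a : A) (r : ℝ) (w : ℂ) : A :=
  (2 * π * I : ℂ)⁻¹ • ∮ z in C(0, r), (w - z)⁻¹ • resolvent a z

/-- The Riesz projection onto the part of the spectrum inside a circle centred at `0`. -/
def rieszProjection (a : A) (r : ℝ) : A :=
  (2 * π * I : ℂ)⁻¹ • ∮ z in C(0, r), resolvent a z

theorem circleIntegral_sub_inv_of_lt_norm {r : ℝ} (hr : 0 ≤ r) {w : ℂ} (hw : r < ‖w‖) :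
    (∮ z in C(0, r), (w - z)⁻¹) = 0 := by
  refine DiffContOnCl.circleIntegral_eq_zero hr (DifferentiableOn.diffContOnCl ?_)
  refine DifferentiableOn.inv (by fun_prop) fun z hz => ?_
  have hz' := mem_closedBall_zero_iff.1 (closure_ball_subset_closedBall hz)
  rw [sub_ne_zero]
  rintro rfl
  exact hw.not_ge hz'

theorem circleIntegral_sub_inv_of_norm_lt {r : ℝ} {w : ℂ} (hw : ‖w‖ < r) :
    (∮ z in C(0, r), (w - z)⁻¹) = -(2 * π * I) := by
  rw [← circleIntegral.integral_sub_inv_of_mem_ball (mem_ball_zero_iff.2 hw)]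
  simp only [circleIntegral, ← intervalIntegral.integral_neg]
  congr 1; ext θ
  rw [← neg_sub, inv_neg, smul_neg]

variable [CompleteSpace A]

theorem Commute.circleIntegral_right {b : A} {f : ℂ → A} {c : ℂ} {R : ℝ} (hR : 0 ≤ R)
    (hf : CircleIntegrable f c R) (h : ∀ z ∈ sphere c R, Commute b (f z)) :
    Commute b (∮ z in C(c, R), f z) := by
  have h1 := circleIntegral_clm_apply (ContinuousLinearMap.mul ℂ A b) hf
  have h2 := circleIntegral_clm_apply ((ContinuousLinearMap.mul ℂ A).flip b) hf
  simp only [ContinuousLinearMap.mul_apply', ContinuousLinearMap.flip_apply] at h1 h2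
  rw [Commute, SemiconjBy, h1, h2]
  exact circleIntegral.integral_congr hR h

variable {a : A} {r : ℝ}

theorem circleIntegrable_resolvent (hr : 0 ≤ r) (h : sphere 0 r ⊆ resolventSet ℂ a) :
    CircleIntegrable (resolvent a) 0 r :=
  ((continuousOn_resolvent a).mono h).circleIntegrable hr

theorem sub_ne_zero_of_mem_sphere {w z : ℂ} (hw : ‖w‖ ≠ r) (hz : z ∈ sphere (0 : ℂ) r) :
    w - z ≠ 0 := by
  rw [sub_ne_zero]
  rintro rfl
  exact hw (mem_sphere_zero_iff_norm.1 hz)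

theorem continuousOn_sub_inv {w : ℂ} (hw : ‖w‖ ≠ r) :
    ContinuousOn (fun z => (w - z)⁻¹) (sphere 0 r) :=
  ContinuousOn.inv₀ (by fun_prop) fun _ hz => sub_ne_zero_of_mem_sphere hw hz

theorem circleIntegrable_sub_inv_smul_resolvent (hr : 0 ≤ r) (h : sphere 0 r ⊆ resolventSet ℂ a)
    {w : ℂ} (hw : ‖w‖ ≠ r) :
    CircleIntegrable (fun z => (w - z)⁻¹ • resolvent a z) 0 r :=
  ((continuousOn_sub_inv hw).smul ((continuousOn_resolvent a).mono h)).circleIntegrable hr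

theorem commute_rieszProjection (hr : 0 ≤ r) (h : sphere 0 r ⊆ resolventSet ℂ a) :
    Commute a (rieszProjection a r) :=
  (Commute.circleIntegral_right hr (circleIntegrable_resolvent hr h)
    fun _ hz => commute_resolvent (h hz)).smul_right _

theorem commute_cauchyResolvent (hr : 0 ≤ r) (h : sphere 0 r ⊆ resolventSet ℂ a)
    {w : ℂ} (hw : ‖w‖ ≠ r) : Commute a (cauchyResolvent a r w) :=
  (Commute.circleIntegral_right hr (circleIntegrable_sub_inv_smul_resolvent hr h hw)
    fun _ hz => (commute_resolvent (h hz)).smul_right _).smul_right _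

/-- Write `w - a = (w - z) + (z - a)` under the integral. The remaining scalar integral vanishes for
`w` outside the circle and equals `-2πi` inside, so up to sign the Cauchy transform inverts `w - a`
on the range, respectively the kernel, of the Riesz projection. -/
theorem sub_mul_cauchyResolvent (hr : 0 ≤ r) (h : sphere 0 r ⊆ resolventSet ℂ a)
    {w : ℂ} (hw : ‖w‖ ≠ r) :
    (algebraMap ℂ A w - a) * cauchyResolvent a r w =
      rieszProjection a r + ((2 * π * I : ℂ)⁻¹ * ∮ z in C(0, r), (w - z)⁻¹) • (1 : A) := by
  have h1 := circleIntegral_clm_apply (ContinuousLinearMap.mul ℂ A (algebraMap ℂ A w - a))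
    (circleIntegrable_sub_inv_smul_resolvent hr h hw)
  simp only [ContinuousLinearMap.mul_apply'] at h1
  have h3 : CircleIntegrable (fun z => (w - z)⁻¹ • (1 : A)) 0 r :=
    ((continuousOn_sub_inv hw).smul continuousOn_const).circleIntegrable hr
  rw [cauchyResolvent, rieszProjection, mul_smul_comm, h1, mul_smul, ← smul_add,
    ← circleIntegral.integral_smul_const,
    ← circleIntegral.integral_add (circleIntegrable_resolvent hr h) h3]
  congr 1
  refine circleIntegral.integral_congr hr fun z hz => ?_
  have h2 : (algebraMap ℂ A w - a) = (w - z) • (1 : A) + (algebraMap ℂ A z - a) := by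
    rw [sub_smul, ← Algebra.algebraMap_eq_smul_one, ← Algebra.algebraMap_eq_smul_one]
    abel
  rw [mul_smul_comm, h2, add_mul, mul_resolvent (h hz), smul_mul_assoc, one_mul, smul_add,
    inv_smul_smul₀ (sub_ne_zero_of_mem_sphere hw hz)]

theorem sub_mul_cauchyResolvent_of_lt_norm (hr : 0 ≤ r) (h : sphere 0 r ⊆ resolventSet ℂ a)
    {w : ℂ} (hw : r < ‖w‖) :
    (algebraMap ℂ A w - a) * cauchyResolvent a r w = rieszProjection a r := by
  rw [sub_mul_cauchyResolvent hr h hw.ne', circleIntegral_sub_inv_of_lt_norm hr hw, mul_zero,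
    zero_smul, add_zero]

theorem sub_mul_cauchyResolvent_of_norm_lt (h : sphere 0 r ⊆ resolventSet ℂ a)
    {w : ℂ} (hw : ‖w‖ < r) :
    (algebraMap ℂ A w - a) * cauchyResolvent a r w = rieszProjection a r - 1 := by
  rw [sub_mul_cauchyResolvent ((norm_nonneg w).trans hw.le) h hw.ne,
    circleIntegral_sub_inv_of_norm_lt hw, mul_neg, inv_mul_cancel₀ two_pi_I_ne_zero, neg_smul,
    one_smul, sub_eq_add_neg]

/-- The moduli of the spectrum form a compact set missing `r`, hence missing a neighbourhood of `r`.
The larger circle is what makes the two contours in the proof of idempotence disjoint. -/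
theorem exists_gt_annulus_subset_resolventSet (h : sphere 0 r ⊆ resolventSet ℂ a) :
    ∃ R, r < R ∧ closedBall 0 R \ ball 0 r ⊆ resolventSet ℂ a := by
  have hK : IsClosed (norm '' spectrum ℂ a) :=
    ((spectrum.isCompact a).image continuous_norm).isClosed
  have hr : (norm '' spectrum ℂ a)ᶜ ∈ 𝓝 r := by
    refine hK.isOpen_compl.mem_nhds ?_
    rintro ⟨z, hz, hzr⟩
    exact hz (h (mem_sphere_zero_iff_norm.2 hzr))
  obtain ⟨ε, hε, hb⟩ := nhds_basis_closedBall.mem_iff.1 hr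
  refine ⟨r + ε, by linarith, ?_⟩
  rintro z ⟨hz, hz'⟩
  rw [mem_closedBall_zero_iff] at hz
  rw [mem_ball_zero_iff, not_lt] at hz'
  by_contra hzs
  refine hb (a := ‖z‖) ?_ ⟨z, hzs, rfl⟩
  rw [mem_closedBall, Real.dist_eq, abs_of_nonneg (by linarith)]
  linarith

/-- By Cauchy's theorem the circles of radii `r < R` give the same element, so the square is a
product over two disjoint contours. For `w` on the outer circle the resolvent times the inner
projection is the Cauchy transform at `w`; after exchanging the integrals, the outer one contributes
`∮ (w - z)⁻¹ dw = 2πi`. -/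
theorem isIdempotentElem_rieszProjection (hr : 0 < r) (h : sphere 0 r ⊆ resolventSet ℂ a) :
    IsIdempotentElem (rieszProjection a r) := by
  obtain ⟨R, hrR, hR⟩ := exists_gt_annulus_subset_resolventSet h
  have hR0 : 0 ≤ R := hr.le.trans hrR.le
  have hRs : sphere 0 R ⊆ resolventSet ℂ a := by
    refine Subset.trans (fun z hz => ?_) hR
    rw [mem_sphere_zero_iff_norm] at hz
    simp [hz, hrR.le]
  have heq : rieszProjection a R = rieszProjection a r := by
    rw [rieszProjection, rieszProjection]
    congr 1
    refine circleIntegral_eq_of_differentiable_on_annulus_off_countable hr hrR.le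
      countable_empty ((continuousOn_resolvent a).mono hR) ?_
    rintro z ⟨⟨hz, hz'⟩, -⟩
    exact (spectrum.hasDerivAt_resolvent_const_left (hR ⟨ball_subset_closedBall hz,
      fun hz'' => hz' (ball_subset_closedBall hz'')⟩)).differentiableAt
  have hmul : ∀ w ∈ sphere (0 : ℂ) R,
      resolvent a w * rieszProjection a r = cauchyResolvent a r w := by
    intro w hw
    rw [← sub_mul_cauchyResolvent_of_lt_norm hr.le h
      (by rwa [mem_sphere_zero_iff_norm.1 hw] : r < ‖w‖), ← mul_assoc, resolvent_mul (hRs hw),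
      one_mul]
  have h1 := circleIntegral_clm_apply ((ContinuousLinearMap.mul ℂ A).flip (rieszProjection a r))
    (circleIntegrable_resolvent hR0 hRs)
  simp only [ContinuousLinearMap.mul_apply', ContinuousLinearMap.flip_apply] at h1
  rw [circleIntegral.integral_congr hR0 hmul] at h1
  have hne : ∀ p ∈ sphere (0 : ℂ) R ×ˢ sphere (0 : ℂ) r, p.1 - p.2 ≠ 0 := by
    rintro ⟨w, z⟩ ⟨hw, hz⟩
    exact sub_ne_zero_of_mem_sphere (by rw [mem_sphere_zero_iff_norm.1 hw]; exact hrR.ne') hz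
  have h2 : (∮ w in C(0, R), ∮ z in C(0, r), (w - z)⁻¹ • resolvent a z) =
      (2 * π * I : ℂ) • ∮ z in C(0, r), resolvent a z := by
    rw [circleIntegral_comm hR0 hr.le, ← circleIntegral.integral_smul]
    · refine circleIntegral.integral_congr hr.le fun z hz => ?_
      rw [circleIntegral.integral_smul_const, circleIntegral.integral_sub_inv_of_mem_ball]
      rw [mem_ball_zero_iff, mem_sphere_zero_iff_norm.1 hz]
      exact hrR
    · refine ContinuousOn.smul (ContinuousOn.inv₀ (by fun_prop) hne) ?_
      exact ((continuousOn_resolvent a).mono h).comp continuousOn_snd fun p hp => hp.2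
  rw [IsIdempotentElem]
  nth_rewrite 1 [← heq]
  rw [rieszProjection, smul_mul_assoc, h1]
  simp only [cauchyResolvent]
  rw [circleIntegral.integral_smul, h2, inv_smul_smul₀ two_pi_I_ne_zero, rieszProjection]

end RieszProjection

/-! ### Operators and invariant decompositions -/

section Decomposition

open Topology Filter Set

variable {X : Type*} [NormedAddCommGroup X] [NormedSpace ℂ X]

theorem coe_pow_restrict_apply {T : X →L[ℂ] X} {N : Submodule ℂ X} (hN : ∀ x ∈ N, T x ∈ N)
    (n : ℕ) (x : N) : ((T.restrict hN ^ n) x : X) = (T ^ n) x := by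
  induction n generalizing x with
  | zero => rfl
  | succ n ih =>
    rw [pow_succ, pow_succ, mul_apply_eq_comp, mul_apply_eq_comp, ih]
    rfl

theorem isUnit_sub_smul_one_iff (T : X →L[ℂ] X) (z : ℂ) :
    IsUnit (T - z • (1 : X →L[ℂ] X)) ↔ z ∉ spectrum ℂ T := by
  rw [spectrum.notMem_iff, Algebra.algebraMap_eq_smul_one, IsUnit.sub_iff]

theorem eventually_isUnit_sub_smul_one [CompleteSpace X] {T : X →L[ℂ] X} (hT : IsUnit T) :
    ∀ᶠ z in 𝓝 (0 : ℂ), IsUnit (T - z • (1 : X →L[ℂ] X)) := by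
  have h0 : (0 : ℂ) ∈ resolventSet ℂ T := by
    by_contra h
    exact (isUnit_sub_smul_one_iff T 0).1 (by rwa [zero_smul, sub_zero]) h
  filter_upwards [(spectrum.isOpen_resolventSet T).mem_nhds h0] with z hz
  exact (isUnit_sub_smul_one_iff T z).2 fun h => h hz

theorem isUnit_sub_smul_one_of_isNilpotent {T : X →L[ℂ] X} (hT : IsNilpotent T) {z : ℂ}
    (hz : z ≠ 0) : IsUnit (T - z • (1 : X →L[ℂ] X)) := by
  rw [← Algebra.algebraMap_eq_smul_one, sub_eq_add_neg]
  exact hT.isUnit_add_right_of_commute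
    ((Units.mk0 z hz).isUnit.map (algebraMap ℂ (X →L[ℂ] X))).neg
    (Commute.neg_right (Algebra.commutes z T).symm)

namespace Red

variable {T : X →L[ℂ] X} {M N : Submodule ℂ X}

theorem symm (h : Red T M N) : Red T N M :=
  ⟨h.isClosed_right, h.isClosed_left, h.invariant_right, h.invariant_left, h.isCompl.symm⟩

theorem sub_smul_one (h : Red T M N) (z : ℂ) : Red (T - z • (1 : X →L[ℂ] X)) M N where
  isClosed_left := h.isClosed_left
  isClosed_right := h.isClosed_right
  invariant_left x hx := M.sub_mem (h.invariant_left x hx) (M.smul_mem z hx)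
  invariant_right x hx := N.sub_mem (h.invariant_right x hx) (N.smul_mem z hx)
  isCompl := h.isCompl

theorem exists_add_eq (h : Red T M N) (x : X) : ∃ m ∈ M, ∃ n ∈ N, m + n = x := by
  have hx : x ∈ M ⊔ N := h.isCompl.sup_eq_top ▸ Submodule.mem_top
  exact Submodule.mem_sup.1 hx

theorem eq_zero_of_mem (h : Red T M N) {x : X} (hM : x ∈ M) (hN : x ∈ N) : x = 0 :=
  Submodule.disjoint_def.1 h.isCompl.disjoint x hM hN

theorem pow_mem_left (h : Red T M N) (n : ℕ) {x : X} (hx : x ∈ M) : (T ^ n) x ∈ M := by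
  simpa only [coe_pow_restrict_apply] using ((T.restrict h.invariant_left ^ n) ⟨x, hx⟩).2

theorem pow_mem_right (h : Red T M N) (n : ℕ) {x : X} (hx : x ∈ N) : (T ^ n) x ∈ N :=
  h.symm.pow_mem_left n hx

/-- If two sums along the decomposition agree, so do their components. -/
theorem eq_of_add_eq (h : Red T M N) {m m' n n' : X} (hm : m ∈ M) (hm' : m' ∈ M) (hn : n ∈ N)
    (hn' : n' ∈ N) (heq : m + n = m' + n') : m = m' ∧ n = n' := by
  have h1 : m - m' = n' - n := by
    rw [sub_eq_sub_iff_add_eq_add, heq, add_comm]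
  have h2 := h.eq_zero_of_mem (M.sub_mem hm hm') (h1 ▸ N.sub_mem hn' hn)
  refine ⟨sub_eq_zero.1 h2, ?_⟩
  rw [h2] at h1
  exact (sub_eq_zero.1 h1.symm).symm

theorem ext {A B : X →L[ℂ] X} (h : Red T M N) (hM : ∀ x : M, A x = B x)
    (hN : ∀ x : N, A x = B x) : A = B := by
  ext x
  obtain ⟨m, hm, n, hn, rfl⟩ := h.exists_add_eq x
  rw [map_add, map_add, hM ⟨m, hm⟩, hN ⟨n, hn⟩]

variable [CompleteSpace X]

theorem isTopCompl (h : Red T M N) : Submodule.IsTopCompl M N :=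
  Submodule.IsCompl.isTopCompl_of_isClosed h.isCompl h.isClosed_left h.isClosed_right

/-- An operator with an inverse on `M` restricts to an invertible operator of `M`. -/
theorem isUnit_restrict_left (h : Red T M N) {S : X → X} (h₁ : ∀ x ∈ M, T (S x) = x)
    (h₂ : ∀ x ∈ M, S (T x) = x) : IsUnit (T.restrict h.invariant_left) := by
  have := h.isClosed_left.completeSpace_coe
  rw [ContinuousLinearMap.isUnit_iff_bijective]
  constructor
  · intro x y hxy
    have h3 : T x = T y := congrArg Subtype.val hxy
    ext
    rw [← h₂ x x.2, h3, h₂ y y.2]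
  · intro x
    -- `S x` need not lie in `M`, but its `M`-component is still a preimage of `x`, since `T`
    -- respects the decomposition.
    obtain ⟨m, hm, n, hn, hmn⟩ := h.exists_add_eq (S x)
    have h3 : T m + T n = x + 0 := by
      rw [← map_add, hmn, h₁ x x.2, add_zero]
    exact ⟨⟨m, hm⟩, Subtype.ext (h.eq_of_add_eq (h.invariant_left m hm) x.2
      (h.invariant_right n hn) N.zero_mem h3).1⟩

theorem isUnit_restrict_left_of_isUnit (h : Red T M N) (hT : IsUnit T) :
    IsUnit (T.restrict h.invariant_left) := by
  obtain ⟨u, rfl⟩ := hT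
  refine h.isUnit_restrict_left (S := (↑u⁻¹ : X →L[ℂ] X)) (fun x _ => ?_) fun x _ => ?_
  · exact DFunLike.congr_fun u.mul_inv x
  · exact DFunLike.congr_fun u.inv_mul x

theorem isUnit_restrict_right_of_isUnit (h : Red T M N) (hT : IsUnit T) :
    IsUnit (T.restrict h.invariant_right) :=
  h.symm.isUnit_restrict_left_of_isUnit hT

/-- The operator on `X = M ⊕ N` that is `U` on `M` and `V` on `N`. -/
def glue (h : Red T M N) (U : M →L[ℂ] M) (V : N →L[ℂ] N) : X →L[ℂ] X :=
  M.subtypeL ∘L U ∘L M.projectionOntoL N h.isTopCompl +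
    N.subtypeL ∘L V ∘L N.projectionOntoL M h.symm.isTopCompl

@[simp]
theorem glue_apply_left (h : Red T M N) (U : M →L[ℂ] M) (V : N →L[ℂ] N) (x : M) :
    h.glue U V x = U x := by
  simp [glue]

@[simp]
theorem glue_apply_right (h : Red T M N) (U : M →L[ℂ] M) (V : N →L[ℂ] N) (x : N) :
    h.glue U V x = V x := by
  simp [glue]

theorem glue_restrict (h : Red T M N) :
    h.glue (T.restrict h.invariant_left) (T.restrict h.invariant_right) = T := by
  apply h.ext <;> intro x <;> simp

theorem glue_mul (h : Red T M N) (U U' : M →L[ℂ] M) (V V' : N →L[ℂ] N) :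
    h.glue U V * h.glue U' V' = h.glue (U * U') (V * V') := by
  apply h.ext <;> intro x <;> simp

theorem glue_one (h : Red T M N) : h.glue 1 1 = 1 := by
  apply h.ext <;> intro x <;> simp

theorem glue_pow (h : Red T M N) (U : M →L[ℂ] M) (V : N →L[ℂ] N) (n : ℕ) :
    h.glue U V ^ n = h.glue (U ^ n) (V ^ n) := by
  induction n with
  | zero => simp only [pow_zero, glue_one]
  | succ n ih => simp only [pow_succ, ih, glue_mul]

theorem isUnit_of_restrict (h : Red T M N) (hM : IsUnit (T.restrict h.invariant_left))
    (hN : IsUnit (T.restrict h.invariant_right)) : IsUnit T := by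
  obtain ⟨U, hU⟩ := hM
  obtain ⟨V, hV⟩ := hN
  rw [← h.glue_restrict, ← hU, ← hV]
  refine isUnit_iff_exists.2 ⟨h.glue ↑U⁻¹ ↑V⁻¹, ?_, ?_⟩ <;> simp [glue_mul, glue_one]

end Red

/-- The kernel is the left summand because the left summand is the one where `T` is to be
invertible, while the range of the Riesz projection carries the spectrum inside the circle. -/
theorem red_of_isIdempotentElem {T e : X →L[ℂ] X} (he : IsIdempotentElem e) (hc : Commute T e) :
    Red T e.ker e.range := by
  have hc' : ∀ x, T (e x) = e (T x) := DFunLike.congr_fun hc.eq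
  have he' : ∀ x, e (e x) = e x := DFunLike.congr_fun he.eq
  have hr : e.range = (1 - e).ker := by
    ext x
    constructor
    · rintro ⟨y, rfl⟩
      simp [he']
    · intro hx
      exact ⟨x, (sub_eq_zero.1 hx).symm⟩
  refine ⟨e.isClosed_ker, hr ▸ (1 - e).isClosed_ker, fun x hx => ?_, ?_, ?_⟩
  · have hx : e x = 0 := hx
    show e (T x) = 0
    rw [← hc', hx, map_zero]
  · rintro _ ⟨x, rfl⟩
    exact ⟨T x, (hc' x).symm⟩
  · constructor
    · rw [Submodule.disjoint_def]
      rintro _ hx ⟨x, rfl⟩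
      have hx : e (e x) = 0 := hx
      rwa [he'] at hx
    · rw [codisjoint_iff, eq_top_iff]
      intro x _
      refine Submodule.mem_sup.2 ⟨x - e x, ?_, e x, ⟨x, rfl⟩, sub_add_cancel _ _⟩
      show e (x - e x) = 0
      rw [map_sub, he', sub_self]

variable [CompleteSpace X]

/-- An operator that is invertible on `M` and nilpotent on `N` is invertible after every small
nonzero translation. -/
theorem Red.eventually_isUnit_of_isNilpotent {T : X →L[ℂ] X} {M N : Submodule ℂ X} (h : Red T M N)
    (hM : IsUnit (T.restrict h.invariant_left)) (hN : IsNilpotent (T.restrict h.invariant_right)) :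
    ∀ᶠ z in 𝓝[≠] (0 : ℂ), IsUnit (T - z • (1 : X →L[ℂ] X)) := by
  have := h.isClosed_left.completeSpace_coe
  filter_upwards [eventually_nhdsWithin_of_eventually_nhds
    (eventually_isUnit_sub_smul_one hM), self_mem_nhdsWithin] with z hz hz0
  exact (h.sub_smul_one z).isUnit_of_restrict hz (isUnit_sub_smul_one_of_isNilpotent hN hz0)

end Decomposition

/-! ### Drazin and Browder operators -/

section DrazinBrowder

open Topology Filter Set

variable {X : Type*} [NormedAddCommGroup X] [NormedSpace ℂ X]

theorem isDrazinInvertible_of_isUnit {T : X →L[ℂ] X} (hT : IsUnit T) : IsDrazinInvertible T := by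
  obtain ⟨u, rfl⟩ := hT
  exact ⟨↑u⁻¹, by simp, by simp, 0, by simp⟩

/-- An operator is Fredholm iff it is invertible modulo finite rank operators. -/
theorem isFredholm_iff_exists_hasFiniteRange {T : X →L[ℂ] X} :
    T.IsFredholm ↔ ∃ S : X →L[ℂ] X, (S * T - 1).toLinearMap.HasFiniteRange ∧
      (T * S - 1).toLinearMap.HasFiniteRange := by
  rw [ContinuousLinearMap.isFredholm_iff_exists_isQuasiInverse]
  refine exists_congr fun S => and_congr ?_ ?_
  · exact LinearMap.FiniteRangeSetoid.equiv_iff_hasFiniteRange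
  · exact LinearMap.FiniteRangeSetoid.equiv_iff_hasFiniteRange

theorem IsFredholm.pow {T : X →L[ℂ] X} (hT : T.IsFredholm) (n : ℕ) : (T ^ n).IsFredholm := by
  induction n with
  | zero => exact isFredholm_iff_exists_hasFiniteRange.2 ⟨1, by simp, by simp⟩
  | succ n ih =>
    obtain ⟨S, hS⟩ := hT.exists_isQuasiInverse
    obtain ⟨S', hS'⟩ := ih.exists_isQuasiInverse
    rw [pow_succ]
    exact .of_isQuasiInverse (v := S * S') (hS.comp hS')

theorem isBrowder_of_isUnit {T : X →L[ℂ] X} (hT : IsUnit T) : IsBrowder T := by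
  obtain ⟨u, rfl⟩ := hT
  refine ⟨isFredholm_iff_exists_hasFiniteRange.2 ⟨↑u⁻¹, by simp, by simp⟩, ⟨0, ?_⟩, ⟨0, ?_⟩⟩
  · ext x
    have h : (↑u⁻¹ : X →L[ℂ] X) ((u : X →L[ℂ] X) x) = x := DFunLike.congr_fun u.inv_mul x
    simp only [pow_zero, zero_add, pow_one, LinearMap.mem_ker, ContinuousLinearMap.coe_coe]
    exact ⟨fun hx => by rw [show x = 0 from hx, map_zero], fun hx => by
      rw [← h, hx, map_zero, map_zero]⟩
  · ext x
    have h : (u : X →L[ℂ] X) ((↑u⁻¹ : X →L[ℂ] X) x) = x := DFunLike.congr_fun u.mul_inv x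
    rw [pow_zero, zero_add, pow_one]
    exact ⟨fun _ => ⟨_, h⟩, fun _ => ⟨x, rfl⟩⟩

theorem hasFiniteAscent_iff {T : X →L[ℂ] X} :
    HasFiniteAscent T ↔ ∃ n : ℕ, ∀ x, (T ^ (n + 1)) x = 0 → (T ^ n) x = 0 := by
  refine exists_congr fun n => ⟨fun h x hx => ?_, fun h => le_antisymm ?_ h⟩
  · exact h.symm.le hx
  · intro x hx
    have hx : (T ^ n) x = 0 := hx
    show (T ^ (n + 1)) x = 0
    rw [pow_succ', mul_apply_eq_comp, hx, map_zero]

theorem hasFiniteDescent_iff {T : X →L[ℂ] X} :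
    HasFiniteDescent T ↔ ∃ n : ℕ, ∀ x, ∃ y, (T ^ (n + 1)) y = (T ^ n) x := by
  refine exists_congr fun n => ⟨fun h x => ?_, fun h => le_antisymm ?_ ?_⟩
  · exact h.le ⟨x, rfl⟩
  · rintro _ ⟨x, rfl⟩
    exact h x
  · rintro _ ⟨x, rfl⟩
    exact ⟨T x, by rw [pow_succ]; rfl⟩

/-- A Drazin inverse commutes with every operator that commutes with the given one. -/
theorem commute_of_drazinInverse {R : Type*} [Ring R] {t s q : R} {k : ℕ} (hts : t * s = s * t)
    (hsts : s * t * s = s) (hk : t ^ (k + 1) * s = t ^ k) (hq : Commute q t) : Commute q s := by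
  have hc : Commute t s := hts
  -- The idempotent `p = ts` equals `t^(k+1) s^(k+1)`, and `t^(k+1)` absorbs `p` on both sides.
  -- Since `q` commutes with `t^(k+1)`, both `pqp = qp` and `pqp = pq` follow, so `q` commutes with
  -- `p`; then `s = ps` and `ts = st` give the claim.
  have hi : IsIdempotentElem (t * s) := by
    rw [IsIdempotentElem, mul_assoc, ← mul_assoc s, hsts]
  have hpow : t ^ (k + 1) * s ^ (k + 1) = t * s := by
    rw [← hc.mul_pow, hi.pow_succ_eq]
  have h1 : t * s * t ^ (k + 1) = t ^ (k + 1) := by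
    rw [mul_assoc, (hc.symm.pow_right (k + 1)).eq, hk, ← pow_succ']
  have h2 : t ^ (k + 1) * (t * s) = t ^ (k + 1) := by
    rw [← mul_assoc, ← pow_succ, pow_succ', mul_assoc, hk, ← pow_succ']
  have hqt : Commute q (t ^ (k + 1)) := hq.pow_right _
  have h3 : t * s * q * (t * s) = q * (t * s) := by
    rw [mul_assoc, ← hpow, ← mul_assoc q, hqt.eq, hpow]
    simp only [← mul_assoc] at h1 ⊢
    rw [h1]
  have h4 : t * s * q * (t * s) = t * s * q := by
    nth_rewrite 1 [← hpow]
    rw [(hc.pow_pow _ _).eq, mul_assoc (s ^ (k + 1)), ← hqt.eq, mul_assoc, mul_assoc, h2, hqt.eq,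
      ← mul_assoc, ← (hc.pow_pow _ _).eq, hpow]
  have h5 : q * (t * s) = t * s * q := h3.symm.trans h4
  calc q * s = q * (t * s) * s := by rw [mul_assoc, hts, hsts]
    _ = s * t * q * s := by rw [h5, hts]
    _ = s * (q * (t * s)) := by rw [mul_assoc s, ← hq.eq, mul_assoc, mul_assoc]
    _ = s * t * s * q := by rw [h5, mul_assoc, mul_assoc, mul_assoc]
    _ = s * q := by rw [hsts]

variable [CompleteSpace X] {T : X →L[ℂ] X} {M N : Submodule ℂ X}

/-- The projection `h.glue 0 1` onto `N` commutes with `T`, hence with the Drazin inverse, which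
therefore preserves `N` and can be restricted. -/
theorem Red.isDrazinInvertible_restrict_right (h : Red T M N) (hT : IsDrazinInvertible T) :
    IsDrazinInvertible (T.restrict h.invariant_right) := by
  obtain ⟨S, h1, h2, k, h3⟩ := hT
  have hq : Commute (h.glue 0 1) T := by
    have : Commute (h.glue 0 1)
        (h.glue (T.restrict h.invariant_left) (T.restrict h.invariant_right)) := by
      rw [Commute, SemiconjBy, glue_mul, glue_mul]
      simp
    rwa [h.glue_restrict] at this
  have hS : ∀ x ∈ N, S x ∈ N := by
    intro x hx
    have h4 := DFunLike.congr_fun (commute_of_drazinInverse h1 h2 h3 hq).eq x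
    obtain ⟨m, hm, n, hn, hmn⟩ := h.exists_add_eq (S x)
    have h5 : h.glue 0 1 (S x) = S x := by
      have : h.glue 0 1 x = x := h.glue_apply_right 0 1 ⟨x, hx⟩
      simpa [this] using h4
    rw [← h5, ← hmn, map_add, h.glue_apply_left 0 1 ⟨m, hm⟩, h.glue_apply_right 0 1 ⟨n, hn⟩]
    simpa using hn
  refine ⟨S.restrict hS, ?_, ?_, k, ?_⟩
  · ext x
    exact DFunLike.congr_fun h1 (x : X)
  · ext x
    exact DFunLike.congr_fun h2 (x : X)
  · ext x
    rw [mul_apply_eq_comp, coe_pow_restrict_apply, coe_pow_restrict_apply]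
    exact DFunLike.congr_fun h3 (x : X)

theorem Red.isDrazinInvertible_of_restrict (h : Red T M N)
    (hM : IsUnit (T.restrict h.invariant_left))
    (hN : IsDrazinInvertible (T.restrict h.invariant_right)) : IsDrazinInvertible T := by
  obtain ⟨U, hU⟩ := hM
  obtain ⟨S, h1, h2, k, h3⟩ := hN
  rw [← h.glue_restrict, ← hU]
  refine ⟨h.glue ↑U⁻¹ S, ?_, ?_, k, ?_⟩
  · simp [glue_mul, h1]
  · simp [glue_mul, h2]
  · rw [glue_pow, glue_pow, glue_mul, h3, pow_succ, Units.mul_inv_cancel_right]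

/-- `TS` is an idempotent commuting with `T`. On its range `S` inverts `T`, and on its kernel `T^k =
T^(k+1) S = T^k (TS)` vanishes. -/
theorem IsDrazinInvertible.eventually_isUnit (hT : IsDrazinInvertible T) :
    ∀ᶠ z in 𝓝[≠] (0 : ℂ), IsUnit (T - z • (1 : X →L[ℂ] X)) := by
  obtain ⟨S, h1, h2, k, h3⟩ := hT
  have hi : IsIdempotentElem (T * S) := by
    rw [IsIdempotentElem, mul_assoc, ← mul_assoc S, h2]
  have hc : Commute T (T * S) := (Commute.refl T).mul_right h1
  have h := red_of_isIdempotentElem hi hc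
  refine h.symm.eventually_isUnit_of_isNilpotent (h.symm.isUnit_restrict_left (S := S) ?_ ?_)
    ⟨k, ?_⟩
  · rintro _ ⟨x, rfl⟩
    exact DFunLike.congr_fun hi.eq x
  · rintro _ ⟨x, rfl⟩
    have := DFunLike.congr_fun hi.eq x
    rw [h1] at this ⊢
    exact this
  · ext x
    rw [coe_pow_restrict_apply, ← h3, pow_succ, mul_assoc]
    have hx : (T * S) (x : X) = 0 := x.2
    rw [mul_apply_eq_comp, hx, map_zero]
    rfl

/-- An inverse `S` modulo finite rank need not preserve `N`, so it is compressed to `πS` on `N`. As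
`π` commutes with `T`, the defects are `π(ST - 1)` and `π(TS - 1)` on `N`, still of finite rank.
Ascent and descent are read off componentwise. -/
theorem Red.isBrowder_restrict_right (h : Red T M N) (hT : IsBrowder T) :
    IsBrowder (T.restrict h.invariant_right) := by
  obtain ⟨hF, hA, hD⟩ := hT
  rw [hasFiniteAscent_iff] at hA
  rw [hasFiniteDescent_iff] at hD
  refine ⟨?_, hasFiniteAscent_iff.2 ?_, hasFiniteDescent_iff.2 ?_⟩
  · rw [isFredholm_iff_exists_hasFiniteRange] at hF ⊢
    obtain ⟨S, hl, hr⟩ := hF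
    let π := N.projectionOntoL M h.symm.isTopCompl
    have hπ : ∀ x, T (π x : X) = π (T x) := by
      intro x
      obtain ⟨a, ha, b, hb, rfl⟩ := h.exists_add_eq x
      have h1 : ∀ a ∈ M, π a = 0 := fun a ha =>
        Submodule.projectionOntoL_apply_right h.symm.isTopCompl ⟨a, ha⟩
      have h2 : ∀ b (hb : b ∈ N), π b = ⟨b, hb⟩ := fun b hb =>
        Submodule.projectionOntoL_apply_left h.symm.isTopCompl ⟨b, hb⟩
      rw [map_add, map_add, map_add, h1 a ha, h1 _ (h.invariant_left a ha), h2 b hb,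
        h2 _ (h.invariant_right b hb), zero_add, zero_add]
    have hπ' : ∀ x : N, π x = x := Submodule.projectionOntoL_apply_left h.symm.isTopCompl
    refine ⟨π ∘L S ∘L N.subtypeL, ?_, ?_⟩
    · convert! (hl.comp_right N.subtype).comp_left π.toLinearMap
      ext x
      simp [hπ']
    · convert! (hr.comp_right N.subtype).comp_left π.toLinearMap
      ext x
      simp [hπ', hπ]
  · obtain ⟨n, hn⟩ := hA
    refine ⟨n, fun x hx => Subtype.ext ?_⟩
    rw [coe_pow_restrict_apply]
    refine hn x ?_
    rw [← coe_pow_restrict_apply h.invariant_right, hx]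
    rfl
  · obtain ⟨n, hn⟩ := hD
    refine ⟨n, fun x => ?_⟩
    obtain ⟨y, hy⟩ := hn x
    obtain ⟨a, ha, b, hb, rfl⟩ := h.exists_add_eq y
    refine ⟨⟨b, hb⟩, Subtype.ext ?_⟩
    rw [coe_pow_restrict_apply, coe_pow_restrict_apply]
    rw [map_add, ← zero_add ((T ^ n) x)] at hy
    exact (h.eq_of_add_eq (h.pow_mem_left _ ha) M.zero_mem (h.pow_mem_right _ hb)
      (h.pow_mem_right _ x.2) hy).2

theorem Red.isBrowder_of_restrict (h : Red T M N)
    (hM : IsUnit (T.restrict h.invariant_left))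
    (hN : IsBrowder (T.restrict h.invariant_right)) : IsBrowder T := by
  obtain ⟨hF, hA, hD⟩ := hN
  rw [hasFiniteAscent_iff] at hA
  rw [hasFiniteDescent_iff] at hD
  obtain ⟨U, hU⟩ := hM
  refine ⟨?_, hasFiniteAscent_iff.2 ?_, hasFiniteDescent_iff.2 ?_⟩
  · rw [isFredholm_iff_exists_hasFiniteRange] at hF ⊢
    obtain ⟨S, hl, hr⟩ := hF
    -- The defect of a glued operator that is the identity on `M` factors through `N`.
    have key : ∀ V : N →L[ℂ] N, (V - 1).toLinearMap.HasFiniteRange →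
        (h.glue 1 V - 1).toLinearMap.HasFiniteRange := by
      intro V hV
      convert! (hV.comp_right
        (N.projectionOntoL M h.symm.isTopCompl).toLinearMap).comp_left N.subtype
      ext x
      obtain ⟨a, ha, b, hb, rfl⟩ := h.exists_add_eq x
      have h1 := Submodule.projectionOntoL_apply_right h.symm.isTopCompl ⟨a, ha⟩
      have h2 := Submodule.projectionOntoL_apply_left h.symm.isTopCompl ⟨b, hb⟩
      have h3 := h.glue_apply_left 1 V ⟨a, ha⟩
      have h4 := h.glue_apply_right 1 V ⟨b, hb⟩
      change h.glue 1 V (a + b) - (a + b) =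
        ((V - 1) (N.projectionOntoL M h.symm.isTopCompl (a + b)) : X)
      rw [map_add, map_add, h1, h2, h3, h4, zero_add]
      simp
    refine ⟨h.glue ↑U⁻¹ S, ?_, ?_⟩
    · have := key _ hl
      rwa [← U.inv_mul, ← glue_mul, hU, h.glue_restrict] at this
    · have := key _ hr
      rwa [← U.mul_inv, ← glue_mul, hU, h.glue_restrict] at this
  · obtain ⟨n, hn⟩ := hA
    refine ⟨n, fun x hx => ?_⟩
    obtain ⟨a, ha, b, hb, rfl⟩ := h.exists_add_eq x
    rw [map_add, ← add_zero (0 : X)] at hx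
    obtain ⟨h1, h2⟩ := h.eq_of_add_eq (h.pow_mem_left _ ha) M.zero_mem (h.pow_mem_right _ hb)
      N.zero_mem hx
    have ha0 : (⟨a, ha⟩ : M) = 0 := by
      have h3 : (T.restrict h.invariant_left ^ (n + 1)) ⟨a, ha⟩ = 0 := by
        ext
        rw [coe_pow_restrict_apply]
        exact h1
      rw [← hU, ← Units.val_pow_eq_pow_val] at h3
      have h4 := DFunLike.congr_fun (U ^ (n + 1)).inv_mul ⟨a, ha⟩
      rw [mul_apply_eq_comp, h3, map_zero] at h4
      exact h4.symm
    have hb0 : (T ^ n) b = 0 := by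
      rw [← coe_pow_restrict_apply h.invariant_right n ⟨b, hb⟩, hn ⟨b, hb⟩, ZeroMemClass.coe_zero]
      ext
      rw [coe_pow_restrict_apply]
      exact h2
    rw [map_add, hb0, show a = 0 from congrArg Subtype.val ha0, map_zero, add_zero]
  · obtain ⟨n, hn⟩ := hD
    refine ⟨n, fun x => ?_⟩
    obtain ⟨a, ha, b, hb, rfl⟩ := h.exists_add_eq x
    obtain ⟨y, hy⟩ := hn ⟨b, hb⟩
    have h1 := congrArg Subtype.val hy
    rw [coe_pow_restrict_apply, coe_pow_restrict_apply] at h1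
    have h2 : T ((↑U⁻¹ : M →L[ℂ] M) ⟨a, ha⟩ : X) = a := by
      have := DFunLike.congr_fun U.mul_inv ⟨a, ha⟩
      rw [hU] at this
      exact congrArg Subtype.val this
    -- On `M` the missing power of `T` is supplied by the inverse: `T^(n+1) U⁻¹ a = T^n a`.
    refine ⟨(↑U⁻¹ : M →L[ℂ] M) ⟨a, ha⟩ + y, ?_⟩
    rw [map_add, map_add, h1, pow_succ, mul_apply_eq_comp, h2]

/-- For `p = n + m`, with `n` and `m` witnessing finite ascent and descent, kernels and ranges of
powers are both stationary from `p` on. Hence `X = R(T^p) ⊕ N(T^p)`, with `T` bijective on the range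
and nilpotent on the kernel. The Fredholm property enters through the closedness of `R(T^p)`. -/
theorem IsBrowder.eventually_isUnit (hT : IsBrowder T) :
    ∀ᶠ z in 𝓝[≠] (0 : ℂ), IsUnit (T - z • (1 : X →L[ℂ] X)) := by
  obtain ⟨hF, hA, hD⟩ := hT
  obtain ⟨n, hn⟩ := hasFiniteAscent_iff.1 hA
  obtain ⟨m, hm⟩ := hasFiniteDescent_iff.1 hD
  have hker : ∀ k x, (T ^ (n + m + k)) x = 0 → (T ^ (n + m)) x = 0 := by
    intro k
    induction k with
    | zero => exact fun x hx => hx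
    | succ k ih =>
      intro x hx
      refine ih x ?_
      rw [show n + m + k = n + (m + k) by ring, pow_add, mul_apply_eq_comp]
      refine hn _ ?_
      rwa [← mul_apply_eq_comp, ← pow_add, show n + 1 + (m + k) = n + m + (k + 1) by ring]
  have hrange : ∀ k x, ∃ y, (T ^ (n + m + k)) y = (T ^ (n + m)) x := by
    intro k
    induction k with
    | zero => exact fun x => ⟨x, rfl⟩
    | succ k ih =>
      intro x
      obtain ⟨y, hy⟩ := ih x
      obtain ⟨y', hy'⟩ := hm y
      refine ⟨y', ?_⟩
      rw [← hy, show n + m + (k + 1) = n + k + (m + 1) by ring, pow_add, mul_apply_eq_comp, hy',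
        ← mul_apply_eq_comp, ← pow_add, show n + k + m = n + m + k by ring]
  have h : Red T (T ^ (n + m)).range (T ^ (n + m)).ker := by
    refine ⟨(IsFredholm.pow hF _).isClosed_range, (T ^ (n + m)).isClosed_ker, ?_, ?_, ?_, ?_⟩
    · rintro _ ⟨x, rfl⟩
      exact ⟨T x, DFunLike.congr_fun (pow_mul_comm' T (n + m)) x⟩
    · intro x hx
      have hx : (T ^ (n + m)) x = 0 := hx
      show (T ^ (n + m)) (T x) = 0
      rw [← mul_apply_eq_comp, pow_mul_comm', mul_apply_eq_comp, hx, map_zero]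
    · rw [Submodule.disjoint_def]
      rintro _ ⟨x, rfl⟩ hx
      refine hker (n + m) x ?_
      rw [pow_add]
      exact hx
    · rw [codisjoint_iff, eq_top_iff]
      intro x _
      obtain ⟨y, hy⟩ := hrange (n + m) x
      refine Submodule.mem_sup.2 ⟨(T ^ (n + m)) y, ⟨y, rfl⟩, x - (T ^ (n + m)) y, ?_,
        add_sub_cancel _ _⟩
      show (T ^ (n + m)) (x - (T ^ (n + m)) y) = 0
      rw [map_sub, ← hy, pow_add T (n + m) (n + m), mul_apply_eq_comp, sub_self]
  have := h.isClosed_left.completeSpace_coe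
  refine h.eventually_isUnit_of_isNilpotent
    (ContinuousLinearMap.isUnit_iff_bijective.2 ⟨?_, ?_⟩) ⟨n + m, ?_⟩
  · rw [injective_iff_map_eq_zero]
    rintro ⟨_, x, rfl⟩ hx
    refine Subtype.ext (hker 1 x ?_)
    rw [pow_succ']
    exact congrArg Subtype.val hx
  · rintro ⟨_, x, rfl⟩
    obtain ⟨y, hy⟩ := hrange 1 x
    refine ⟨⟨(T ^ (n + m)) y, y, rfl⟩, Subtype.ext ?_⟩
    rw [pow_succ'] at hy
    exact hy
  · ext x
    rw [coe_pow_restrict_apply]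
    exact x.2

end DrazinBrowder

/-! ### The spectra `σ_*` -/

section Spectra

open Topology Filter Set Metric

variable {X : Type*} [NormedAddCommGroup X] [NormedSpace ℂ X]
  {T : X →L[ℂ] X} {M N : Submodule ℂ X} (k : SpectrumKind)

theorem eventually_sub_smul_one {p : (X →L[ℂ] X) → Prop} {z : ℂ}
    (h : ∀ᶠ w in 𝓝[≠] (0 : ℂ), p (T - z • (1 : X →L[ℂ] X) - w • (1 : X →L[ℂ] X))) :
    ∀ᶠ w in 𝓝[≠] z, p (T - w • (1 : X →L[ℂ] X)) := by
  have ht : Tendsto (fun w => w - z) (𝓝[≠] z) (𝓝[≠] 0) := by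
    refine tendsto_nhdsWithin_iff.2 ⟨?_, ?_⟩
    · refine tendsto_nhdsWithin_of_tendsto_nhds ?_
      simpa using (continuous_sub_right z).tendsto z
    · filter_upwards [self_mem_nhdsWithin] with w hw
      exact sub_ne_zero.2 hw
  filter_upwards [ht.eventually h] with w hw
  rwa [sub_smul, sub_sub, add_sub_cancel] at hw

theorem sigmaStar_subset_spectrum : sigmaStar k T ⊆ spectrum ℂ T := by
  intro z hz
  by_contra h
  rw [← isUnit_sub_smul_one_iff] at h
  cases k with
  | ordinary => exact (isUnit_sub_smul_one_iff T z).1 h hz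
  | browder => exact hz (isBrowder_of_isUnit h)
  | drazin => exact hz (isDrazinInvertible_of_isUnit h)

variable [CompleteSpace X]

/-- The points of the spectrum outside `σ_*` are isolated in the spectrum. -/
theorem eventually_notMem_spectrum_of_notMem_sigmaStar {z : ℂ} (hz : z ∉ sigmaStar k T) :
    ∀ᶠ w in 𝓝[≠] z, w ∉ spectrum ℂ T := by
  simp only [← isUnit_sub_smul_one_iff]
  cases k with
  | ordinary =>
    refine eventually_sub_smul_one (eventually_nhdsWithin_of_eventually_nhds
      (eventually_isUnit_sub_smul_one ((isUnit_sub_smul_one_iff T z).2 hz)))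
  | browder => exact eventually_sub_smul_one (not_not.1 hz : IsBrowder _).eventually_isUnit
  | drazin =>
    exact eventually_sub_smul_one (not_not.1 hz : IsDrazinInvertible _).eventually_isUnit

/-- A point off `σ_*` has a punctured neighbourhood in the resolvent set, and this neighbourhood
avoids the smaller set `σ_*` as well. -/
theorem isClosed_sigmaStar : IsClosed (sigmaStar k T) := by
  rw [← isOpen_compl_iff, isOpen_iff_mem_nhds]
  intro z hz
  have h := eventually_notMem_spectrum_of_notMem_sigmaStar k hz
  rw [eventually_nhdsWithin_iff] at h
  filter_upwards [h] with w hw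
  by_cases hwz : w = z
  · rwa [hwz]
  · exact fun hw' => hw hwz (sigmaStar_subset_spectrum k hw')

/-- These points are isolated in the spectrum, so they are already missing from its first
derivative. -/
theorem countable_spectrum_diff_sigmaStar : (spectrum ℂ T \ sigmaStar k T).Countable := by
  refine (countable_diff_accIter (spectrum.isClosed T) 1).mono ?_
  rintro z ⟨hz, hz'⟩
  refine ⟨hz, fun h => ?_⟩
  rw [← zero_add (1 : Ordinal), accIter_add_one, accIter_zero, mem_derivedSet,
    accPt_iff_frequently_nhdsNE] at h
  exact h (eventually_notMem_spectrum_of_notMem_sigmaStar k hz')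

theorem Red.sigmaStar_restrict_right_subset (h : Red T M N) :
    sigmaStar k (T.restrict h.invariant_right) ⊆ sigmaStar k T := by
  intro z hz
  by_contra hz'
  cases k with
  | ordinary =>
    rw [sigmaStar, ← isUnit_sub_smul_one_iff] at hz'
    exact (isUnit_sub_smul_one_iff _ z).1
      ((h.sub_smul_one z).isUnit_restrict_right_of_isUnit hz') hz
  | browder => exact hz ((h.sub_smul_one z).isBrowder_restrict_right (not_not.1 hz'))
  | drazin => exact hz ((h.sub_smul_one z).isDrazinInvertible_restrict_right (not_not.1 hz'))

/-- If `T` is invertible on `M`, then near `0` the set `σ_*(T)` is contained in that of the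
restriction to `N`. -/
theorem Red.eventually_notMem_sigmaStar (h : Red T M N)
    (hM : IsUnit (T.restrict h.invariant_left)) :
    ∀ᶠ z in 𝓝 (0 : ℂ), z ∈ sigmaStar k T → z ∈ sigmaStar k (T.restrict h.invariant_right) := by
  have := h.isClosed_left.completeSpace_coe
  filter_upwards [AlmostInv.eventually_isUnit_sub_smul_one hM] with z hz hzT
  by_contra hzN
  cases k with
  | ordinary =>
    rw [sigmaStar, ← isUnit_sub_smul_one_iff] at hzN
    exact (isUnit_sub_smul_one_iff T z).1 ((h.sub_smul_one z).isUnit_of_restrict hz hzN) hzT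
  | browder => exact hzT ((h.sub_smul_one z).isBrowder_of_restrict hz (not_not.1 hzN))
  | drazin => exact hzT ((h.sub_smul_one z).isDrazinInvertible_of_restrict hz (not_not.1 hzN))

/-- A circle around `0` in the resolvent set of `T` splits off the part of `T` with spectrum
inside the circle. -/
theorem exists_red_of_sphere_subset_resolventSet {r : ℝ} (hr : 0 < r)
    (h : sphere 0 r ⊆ resolventSet ℂ T) :
    ∃ (M N : Submodule ℂ X) (hMN : Red T M N), IsUnit (T.restrict hMN.invariant_left) ∧
      spectrum ℂ (T.restrict hMN.invariant_right) ⊆ closedBall 0 r := by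
  have hi := isIdempotentElem_rieszProjection hr h
  have hred := red_of_isIdempotentElem hi (commute_rieszProjection hr.le h)
  refine ⟨_, _, hred, ?_, ?_⟩
  -- At `w = 0`, inside the circle, `-T C = P - 1` for the Cauchy transform `C` and the Riesz
  -- projection `P`, so `C` inverts `T` on the kernel of `P`.
  · have h0 : ‖(0 : ℂ)‖ < r := by rwa [norm_zero]
    have h1 := sub_mul_cauchyResolvent_of_norm_lt h h0
    rw [map_zero, zero_sub, neg_mul, ← mul_neg] at h1
    have h2 := (commute_cauchyResolvent hr.le h h0.ne).eq
    refine hred.isUnit_restrict_left (S := (cauchyResolvent T r 0 : X →L[ℂ] X)) ?_ ?_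
    · intro x hx
      have hx : rieszProjection T r x = 0 := hx
      have := DFunLike.congr_fun h1 x
      simp [hx] at this
      exact this
    · intro x hx
      have hx : rieszProjection T r x = 0 := hx
      rw [mul_neg, h2] at h1
      have := DFunLike.congr_fun h1 x
      simp [hx] at this
      exact this
  · intro z hz
    by_contra hzr
    rw [mem_closedBall_zero_iff, not_le] at hzr
    -- For `z` outside the circle `(z - T) C = P`, so `-C` inverts `T - z` on the range of `P`.
    have h1 : (T - z • (1 : X →L[ℂ] X)) * -cauchyResolvent T r z = rieszProjection T r := by
      rw [← sub_mul_cauchyResolvent_of_lt_norm hr.le h hzr, Algebra.algebraMap_eq_smul_one,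
        mul_neg, ← neg_mul, neg_sub]
    have h2 : -cauchyResolvent T r z * (T - z • (1 : X →L[ℂ] X)) = rieszProjection T r := by
      rw [← h1, ← Algebra.algebraMap_eq_smul_one]
      exact (((commute_cauchyResolvent hr.le h hzr.ne').sub_left
        (Algebra.commutes z (cauchyResolvent T r z))).neg_right).symm
    refine (isUnit_sub_smul_one_iff _ z).1 ?_ hz
    refine ((hred.sub_smul_one z).symm.isUnit_restrict_left
      (S := (-cauchyResolvent T r z : X →L[ℂ] X)) ?_ ?_)
    · rintro _ ⟨x, rfl⟩
      exact (DFunLike.congr_fun h1 _).trans (DFunLike.congr_fun hi.eq x)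
    · rintro _ ⟨x, rfl⟩
      exact (DFunLike.congr_fun h2 _).trans (DFunLike.congr_fun hi.eq x)

/-- The moduli of the points of `K ∩ U` are countable, so their complement is dense in `ℝ` and
contains arbitrarily small positive radii. -/
theorem exists_sphere_subset_compl {K U : Set ℂ} (hU : U ∈ 𝓝 0) (hK : (K ∩ U).Countable) :
    ∃ r > 0, closedBall 0 r ⊆ U ∧ sphere 0 r ⊆ Kᶜ := by
  obtain ⟨ε, hε, hεU⟩ := nhds_basis_ball.mem_iff.1 hU
  obtain ⟨r, hr, hr0, hrε⟩ :=
    ((hK.image norm).dense_compl ℝ).exists_between hε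
  have hsub : closedBall (0 : ℂ) r ⊆ U := (closedBall_subset_ball hrε).trans hεU
  refine ⟨r, hr0, hsub, fun z hz hzK => hr ⟨z, ⟨hzK, ?_⟩, mem_sphere_zero_iff_norm.1 hz⟩⟩
  exact hsub (sphere_subset_closedBall hz)

/-- The splitting of an operator whose spectrum is countable near `0`. -/
theorem exists_red_of_countable {U : Set ℂ} (hU : U ∈ 𝓝 0) (hc : (sigmaStar k T ∩ U).Countable) :
    ∃ (M N : Submodule ℂ X) (hMN : Red T M N), IsUnit (T.restrict hMN.invariant_left) ∧
      ∃ r, closedBall 0 r ⊆ U ∧ spectrum ℂ (T.restrict hMN.invariant_right) ⊆ closedBall 0 r := by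
  have hc' : (spectrum ℂ T ∩ U).Countable := by
    refine (hc.union (countable_spectrum_diff_sigmaStar k (T := T))).mono ?_
    rintro z ⟨hz, hzU⟩
    by_cases hzk : z ∈ sigmaStar k T
    · exact .inl ⟨hzk, hzU⟩
    · exact .inr ⟨hz, hzk⟩
  obtain ⟨r, hr0, hrU, hr⟩ := exists_sphere_subset_compl hU hc'
  obtain ⟨M, N, hMN, hM, hN⟩ := exists_red_of_sphere_subset_resolventSet hr0
    fun z hz => not_not.1 (hr hz)
  exact ⟨M, N, hMN, hM, r, hrU, hN⟩

end Spectra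

/-! ### Almost invertible and `g`-invertible operators -/

section Characterizations

open Topology Filter Set Metric

variable {X : Type*} [NormedAddCommGroup X] [NormedSpace ℂ X]
  {T : X →L[ℂ] X} (k : SpectrumKind)

theorem sigmaStar_sub_smul_one (z : ℂ) :
    sigmaStar k (T - z • (1 : X →L[ℂ] X)) = Homeomorph.addRight z ⁻¹' sigmaStar k T := by
  have h : ∀ w : ℂ, T - z • (1 : X →L[ℂ] X) - w • (1 : X →L[ℂ] X) =
      T - (w + z) • (1 : X →L[ℂ] X) := fun w => by
    rw [sub_sub, ← add_smul, add_comm]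
  ext w
  cases k with
  | ordinary =>
    simp only [sigmaStar, mem_preimage, Homeomorph.coe_addRight]
    rw [← not_iff_not, ← isUnit_sub_smul_one_iff, ← isUnit_sub_smul_one_iff, h]
  | browder =>
    simp only [sigmaStar, browderSpectrum, mem_preimage, Homeomorph.coe_addRight, mem_ofPred_eq, h]
  | drazin =>
    simp only [sigmaStar, drazinSpectrum, mem_preimage, Homeomorph.coe_addRight, mem_ofPred_eq, h]

variable [CompleteSpace X]

/-- Both sides say that `σ_*(T)` is countable near `0`. Given a splitting, `σ_*(T)` lies in `σ(T_N)`
near `0`. Conversely, the splitting by a small circle puts `σ(T_N)` inside `σ(T) ∩ U`, which exceeds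
`σ_*(T) ∩ U` by countably many points only. -/
theorem almostInvertible_iff : AlmostInvertible T ↔ (0 : ℂ) ∉ accIter (sigmaStar k T) ω₁ := by
  rw [notMem_accIter_omega_one_iff (isClosed_sigmaStar k)]
  constructor
  · rintro ⟨M, N, h, hM, hN⟩
    have := h.isClosed_right.completeSpace_coe
    refine ⟨_, h.eventually_notMem_sigmaStar k hM, hN.mono ?_⟩
    rintro z ⟨hz, hzU⟩
    exact sigmaStar_subset_spectrum k (hzU hz)
  · rintro ⟨U, hU, hc⟩
    obtain ⟨M, N, h, hM, r, hr, hN⟩ := exists_red_of_countable k hU hc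
    refine ⟨M, N, h, hM, ?_⟩
    refine (hc.union (countable_spectrum_diff_sigmaStar k (T := T))).mono fun z hz => ?_
    by_cases hzk : z ∈ sigmaStar k T
    · exact .inl ⟨hzk, hr (hN hz)⟩
    · exact .inr ⟨h.sigmaStar_restrict_right_subset .ordinary hz, hzk⟩

/-- Locality of `acc^β` carries `acc^β σ_*(T_N) ⊆ {0}` to `σ_*(T)` near `0`. Conversely, a splitting
with `σ(T_N)` inside a small disc works, as `acc^β` is monotone and `σ_*(T_N) ⊆ σ_*(T)`. -/
theorem gInvertibleSucc_iff (β : Ordinal.{0}) :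
    GInvertibleSucc k T β ↔ (0 : ℂ) ∉ accIter (sigmaStar k T) (β + 1) := by
  rw [accIter_add_one, mem_derivedSet, accPt_iff_nhds]
  push Not
  constructor
  · rintro ⟨M, N, h, hM, hN⟩
    obtain ⟨U, hUs, hU, h0⟩ := _root_.mem_nhds_iff.1 (h.eventually_notMem_sigmaStar k hM)
    refine ⟨U, hU.mem_nhds h0, fun y hy => hN ?_⟩
    exact accIter_inter_subset hU (fun z hz => hUs hz.2 hz.1) β ⟨hy.2, hy.1⟩
  · rintro ⟨U, hU, h0⟩
    -- A point of `σ_*(T) ∩ U` either is lost by stage `β`, which happens to countably many points,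
    -- or is `0`.
    have hc : (sigmaStar k T ∩ U).Countable := by
      refine ((countable_diff_accIter (isClosed_sigmaStar k (T := T)) β).union
        (countable_singleton 0)).mono ?_
      rintro z ⟨hz, hzU⟩
      by_cases hzβ : z ∈ accIter (sigmaStar k T) β
      · exact .inr (h0 z ⟨hzU, hzβ⟩)
      · exact .inl ⟨hz, hzβ⟩
    obtain ⟨M, N, h, hM, r, hr, hN⟩ := exists_red_of_countable k hU hc
    refine ⟨M, N, h, hM, fun z hz => h0 z ⟨?_, ?_⟩⟩
    · have := h.isClosed_right.completeSpace_coe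
      exact hr (hN (sigmaStar_subset_spectrum k (accIter_subset (isClosed_sigmaStar k) β hz)))
    · exact accIter_mono (h.sigmaStar_restrict_right_subset k) β hz

theorem gInvertible_iff (α : Ordinal.{0}) :
    GInvertible k T α ↔ (0 : ℂ) ∉ accIter (sigmaStar k T) α := by
  have hcl := isClosed_sigmaStar k (T := T)
  simp only [GInvertible, gInvertibleSucc_iff]
  constructor
  · rintro (⟨rfl, h⟩ | ⟨β, rfl, h⟩ | ⟨-, β, hβ, h⟩)
    · rwa [accIter_zero]
    · exact h
    · exact fun h' => h (accIter_antitone hcl hβ.le h')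
  · intro h
    rcases Ordinal.zero_or_succ_or_isSuccLimit α with rfl | ⟨β, rfl⟩ | hα
    · exact .inl ⟨rfl, by rwa [accIter_zero] at h⟩
    · exact .inr (.inl ⟨β, rfl, h⟩)
    · refine .inr (.inr ⟨hα, ?_⟩)
      rw [accIter_limit _ hα] at h
      simp only [mem_iInter, not_forall] at h
      obtain ⟨β, hβ, h⟩ := h
      -- At a limit, `0` is already missing from some `acc^β` with `β < α`, hence also from
      -- `acc^{β+1}`, and `β + 1 < α` is the successor required.
      exact ⟨β, hα.add_one_lt hβ, fun h' => h (accIter_antitone hcl (Order.le_succ β) h')⟩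

theorem sigmaAl_eq_accIter : sigmaAl T = accIter (sigmaStar k T) ω₁ := by
  ext z
  rw [sigmaAl, mem_ofPred_eq, almostInvertible_iff k, not_not, sigmaStar_sub_smul_one,
    accIter_preimage_homeomorph, mem_preimage, Homeomorph.coe_addRight]
  simp only [zero_add]

end Characterizations

end AlmostInv

end

theorem mainTheorem1 {X : Type*} [NormedAddCommGroup X] [NormedSpace ℂ X] [CompleteSpace X]
    (k : AlmostInv.SpectrumKind) :
    (∀ T : X →L[ℂ] X,
      (AlmostInv.AlmostInvertible T ↔ AlmostInv.GInvertible k T ω₁) ∧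
      (AlmostInv.GInvertible k T ω₁ ↔
        AlmostInv.GInvertible k T (AlmostInv.cbRank (AlmostInv.sigmaStar k T))) ∧
      AlmostInv.sigmaAl T = AlmostInv.accIter (AlmostInv.sigmaStar k T) ω₁ ∧
      AlmostInv.accIter (AlmostInv.sigmaStar k T) ω₁ =
        AlmostInv.accIter (AlmostInv.sigmaStar k T)
          (AlmostInv.cbRank (AlmostInv.sigmaStar k T)) ∧
      (AlmostInv.AlmostInvertible T ↔ (0 : ℂ) ∉ AlmostInv.accIter (spectrum ℂ T) ω₁)) ∧
    {T : X →L[ℂ] X | AlmostInv.AlmostInvertible T} =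
      {T : X →L[ℂ] X | AlmostInv.GInvertible k T ω₁} ∧
    {T : X →L[ℂ] X | AlmostInv.GInvertible k T ω₁} =
      {T : X →L[ℂ] X |
        AlmostInv.GInvertible k T (AlmostInv.cbRank (AlmostInv.sigmaStar k T))} := by
  have h₁ : ∀ T : X →L[ℂ] X, AlmostInv.AlmostInvertible T ↔ AlmostInv.GInvertible k T ω₁ :=
    fun T => (AlmostInv.almostInvertible_iff k).trans (AlmostInv.gInvertible_iff k ω₁).symm
  have h₂ : ∀ T : X →L[ℂ] X, AlmostInv.accIter (AlmostInv.sigmaStar k T) ω₁ =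
      AlmostInv.accIter (AlmostInv.sigmaStar k T)
        (AlmostInv.cbRank (AlmostInv.sigmaStar k T)) :=
    fun T => AlmostInv.accIter_omega_one (AlmostInv.isClosed_sigmaStar k)
  have h₃ : ∀ T : X →L[ℂ] X, AlmostInv.GInvertible k T ω₁ ↔
      AlmostInv.GInvertible k T (AlmostInv.cbRank (AlmostInv.sigmaStar k T)) := fun T => by
    rw [AlmostInv.gInvertible_iff, AlmostInv.gInvertible_iff, h₂]
  exact ⟨fun T => ⟨h₁ T, h₃ T, AlmostInv.sigmaAl_eq_accIter k, h₂ T,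
    AlmostInv.almostInvertible_iff .ordinary⟩, Set.ext h₁, Set.ext h₃⟩
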